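/- A hypergraph $H$ consists of a finite vertex set $V(H)$ and a set $E(H)$ of subsets of $V(H)$ (hyperedges), each of size at least $2$. A set $W\subseteq V(H)$ is independent if it contains no hyperedge; $\alpha(H)$ is the maximum size of an independent set, and $\chi(H)$ is the minimum number of colors in a coloring of $V(H)$ whose color classes are all independent. A subhypergraph of $H$ is a hypergraph $H'$ with $V(H')\subseteq V(H)$ and $E(H')\subseteq E(H)$. Contracting a hyperedge $e$ of $H$ means merging all vertices of $e$ into a single vertex: the hyperedges contained in $e$ are removed, every other hyperedge is replaced by its image, and repeated hyperedges are identified. A hypergraph is a minor of $H$ if it is isomorphic to a hypergraph obtained from $H$ by a finite sequence of operations, each of which is either moving to a subhypergraph or contracting a hyperedge. Let $K_t$ denote the complete graph on $t$ vertices, regarded as a hypergraph. **Theorem.** Let $t\ge 2$ be an integer, and let $H$ be a hypergraph with $\alpha(H)\le 2$. If $H$ does not contain $K_t$ as a minor, then $\chi(H)\le\left\lceil\frac32(t-1)\right\rceil$. -/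

import Mathlib

namespace Hypergraph

/-- A hypergraph in the strict sense: finitely many vertices, and every hyperedge has at least two
vertices (so there are neither empty hyperedges nor loops). -/
def IsFiniteLoopless {α : Type*} (H : Hypergraph α) : Prop :=
  H.vertexSet.Finite ∧ ∀ e ∈ H.edgeSet, 2 ≤ e.encard

/-- `W` is an independent set of vertices: no hyperedge is contained in `W`. -/
def IsIndependent {α : Type*} (H : Hypergraph α) (W : Set α) : Prop :=
  W ⊆ H.vertexSet ∧ ∀ e ∈ H.edgeSet, ¬ e ⊆ W

/-- The independence number: the maximum size of an independent set. -/
noncomputable def independenceNumber {α : Type*} (H : Hypergraph α) : ℕ∞ :=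
  ⨆ (W : Set α) (_ : H.IsIndependent W), W.encard

/-- A proper coloring: every color class is independent. -/
def IsProperColoring {α S : Type*} (H : Hypergraph α) (c : H.vertexSet → S) : Prop :=
  ∀ s : S, H.IsIndependent (Subtype.val '' (c ⁻¹' {s}))

/-- The chromatic number: the minimum size of a color set admitting a proper coloring. -/
noncomputable def chromaticNumber {α : Type*} (H : Hypergraph α) : ℕ∞ :=
  ⨅ (k : ℕ) (_ : ∃ c : H.vertexSet → Fin k, H.IsProperColoring c), (k : ℕ∞)

/-- `H₁` is a subhypergraph of `H₂`. -/
def IsSubhypergraph {α : Type*} (H₁ H₂ : Hypergraph α) : Prop :=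
  H₁.vertexSet ⊆ H₂.vertexSet ∧ H₁.edgeSet ⊆ H₂.edgeSet

open Classical in
/-- The map that sends every vertex of `e` to `v` and fixes all other vertices. -/
noncomputable def contractMap {α : Type*} (e : Set α) (v : α) (x : α) : α :=
  if x ∈ e then v else x

/-- `H / e`: the vertices of `e` are merged into the single vertex `v`; the hyperedges contained
in `e` disappear and all other hyperedges are replaced by their images. -/
def contract {α : Type*} (H : Hypergraph α) (e : Set α) (v : α) : Hypergraph α where
  vertexSet := (H.vertexSet \ e) ∪ {v}
  edgeSet := {g | ∃ f ∈ H.edgeSet, ¬ f ⊆ e ∧ g = contractMap e v '' f}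
  subset_vertexSet_of_mem_edgeSet' := by
    rintro _ ⟨f, hf, -, rfl⟩ _ ⟨x, hx, rfl⟩
    by_cases h : x ∈ e
    · right
      simp [contractMap, h]
    · left
      simpa [contractMap, h] using H.subset_vertexSet_of_mem_edgeSet' hf hx

/-- One operation on hypergraphs: moving to a subhypergraph, or contracting a hyperedge `e`. The
merged vertex may be any `v` that is not a vertex outside `e`; the choice of its name does not
matter up to isomorphism, and allowing `v ∈ e` means that a name is always available. -/
inductive MinorStep {α : Type*} : Hypergraph α → Hypergraph α → Prop
  | sub (H H' : Hypergraph α) (h : H'.IsSubhypergraph H) : MinorStep H H'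
  | contract (H : Hypergraph α) (e : Set α) (he : e ∈ H.edgeSet) (v : α)
      (hv : v ∉ H.vertexSet \ e) : MinorStep H (H.contract e v)

/-- Isomorphism: a bijection of the vertex sets that preserves hyperedges in both directions. -/
def IsIsomorphic {α β : Type*} (G : Hypergraph α) (H : Hypergraph β) : Prop :=
  ∃ φ : G.vertexSet ≃ H.vertexSet, ∀ f : Set G.vertexSet,
    Subtype.val '' f ∈ G.edgeSet ↔ Subtype.val '' (φ '' f) ∈ H.edgeSet

/-- `G` is a minor of `H`: it is isomorphic to a hypergraph obtained from `H` by a finite sequence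
of operations. -/
def IsMinor {α β : Type*} (G : Hypergraph β) (H : Hypergraph α) : Prop :=
  ∃ H' : Hypergraph α, Relation.ReflTransGen MinorStep H H' ∧ G.IsIsomorphic H'

/-- The complete graph `K_t`, whose hyperedges are the two-element sets of vertices. -/
def completeGraph (t : ℕ) : Hypergraph (Fin t) where
  vertexSet := Set.univ
  edgeSet := {e | e.encard = 2}
  subset_vertexSet_of_mem_edgeSet' := fun _ _ => Set.subset_univ _

end Hypergraph

/-! ### Models of complete graphs, and the minors they give -/

namespace Hypergraph

variable {α : Type*} {H : Hypergraph α}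

/-! Fix `k` and let `G` be the graph of vertex pairs that are not hyperedges. Pad its `n` vertices
with `2 * k - n` universal ones; the case `n > 2 * k` is settled by the bound `n ≤ 3 * m` of
`TriplesSpan.exists_hasModel`. A perfect matching of the padded graph gives a proper coloring with
`k` colors. Without one, Tutte's theorem deletes a set `u` leaving at least `|u| + 2` odd components
(`exists_many_components`). Vertices of `H` in different components form hyperedges, so this join
structure improves the bound on models: `|W| + c ≤ 3 * m + 1` for `c` components on the remaining
set `W` (`TriplesSpan.exists_hasModel_of_labelling`). As `|W| + c ≥ 2 * k + 2`, again `2 * k < 3 *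
m`. With `k = ⌈3(t-1)/2⌉` this forces `m ≥ t`, and a model yields the minor (`IsModel.isMinor`). -/

lemma contractMap_of_mem {e : Set α} {v x : α} (h : x ∈ e) : contractMap e v x = v := if_pos h

lemma contractMap_of_notMem {e : Set α} {v x : α} (h : x ∉ e) : contractMap e v x = x := if_neg h

/-- The vertex sets that can be merged into a single vertex by successively contracting
hyperedges. -/
inductive IsContractible (H : Hypergraph α) : Set α → Prop
  | singleton (v : α) (hv : v ∈ H.vertexSet) : IsContractible H {v}
  | union (B e : Set α) (hB : IsContractible H B) (he : e ∈ H.edgeSet) (h : (e ∩ B).Nonempty) :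
      IsContractible H (B ∪ e)

lemma IsContractible.nonempty {B : Set α} (hB : H.IsContractible B) : B.Nonempty := by
  induction hB with
  | singleton v hv => exact ⟨v, rfl⟩
  | union B e _ _ _ ih => exact ih.mono Set.subset_union_left

lemma IsContractible.subset {B : Set α} (hB : H.IsContractible B) : B ⊆ H.vertexSet := by
  induction hB with
  | singleton v hv => simpa using hv
  | union B e _ he _ ih => exact Set.union_subset ih (H.subset_vertexSet_of_mem_edgeSet' he)

lemma image_contractMap_of_disjoint {e f : Set α} (v : α) (h : Disjoint f e) :
    contractMap e v '' f = f := by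
  have : Set.EqOn (contractMap e v) id f := fun x hx =>
    contractMap_of_notMem (Set.disjoint_left.1 h hx)
  rw [this.image_eq, Set.image_id]

lemma contract_singleton (hH : ∀ e ∈ H.edgeSet, e.Nontrivial) {v : α} (hv : v ∈ H.vertexSet) :
    H.contract {v} v = H := by
  have hid : contractMap {v} v = id := by
    funext x
    by_cases h : x = v
    · subst h; exact contractMap_of_mem rfl
    · exact contractMap_of_notMem h
  ext x
  · simp only [contract, Set.sdiff_union_self, Set.mem_union, Set.mem_singleton_iff]
    exact ⟨fun h => h.elim id (fun h => h ▸ hv), Or.inl⟩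
  · simp only [contract, hid, Set.image_id, Set.mem_ofPred_eq]
    constructor
    · rintro ⟨f, hf, -, rfl⟩
      exact hf
    · intro h
      refine ⟨x, h, fun hs => ?_, rfl⟩
      exact Set.not_nontrivial_singleton ((hH x h).mono hs)

/-- Since `e` meets `B`, its image contains `v`, so the preimage of that image under the first
merging map is exactly `B ∪ e`. -/
lemma contract_contract {B e : Set α} {v : α} (hv : v ∈ B) (h : (e ∩ B).Nonempty) :
    (H.contract B v).contract (contractMap B v '' e) v = H.contract (B ∪ e) v := by
  obtain ⟨w, hwe, hwB⟩ := h
  have hve : v ∈ contractMap B v '' e := ⟨w, hwe, contractMap_of_mem hwB⟩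
  have hmem : ∀ x, contractMap B v x ∈ contractMap B v '' e ↔ x ∈ B ∪ e := by
    intro x
    by_cases hx : x ∈ B
    · simp [contractMap_of_mem hx, hve, hx]
    · rw [contractMap_of_notMem hx]
      constructor
      · rintro ⟨y, hy, hyx⟩
        by_cases hyB : y ∈ B
        · rw [contractMap_of_mem hyB] at hyx
          exact absurd (hyx ▸ hv) hx
        · rw [contractMap_of_notMem hyB] at hyx
          exact Or.inr (hyx ▸ hy)
      · rintro (h | h)
        · exact absurd h hx
        · exact ⟨x, h, contractMap_of_notMem hx⟩
  have hcomp : ∀ x, contractMap (contractMap B v '' e) v (contractMap B v x) =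
      contractMap (B ∪ e) v x := by
    intro x
    by_cases hx : x ∈ B ∪ e
    · rw [contractMap_of_mem hx, contractMap_of_mem ((hmem x).2 hx)]
    · rw [contractMap_of_notMem hx, contractMap_of_notMem (fun h => hx ((hmem x).1 h)),
        contractMap_of_notMem (fun h => hx (Or.inl h))]
  ext x
  · simp only [contract, Set.mem_union, Set.mem_sdiff, Set.mem_singleton_iff]
    by_cases hxv : x = v
    · simp [hxv]
    by_cases hx : x ∈ B
    · simp [hxv, hx]
    · have := hmem x
      rw [contractMap_of_notMem hx] at this
      rw [this]
      simp [hxv, hx]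
  · simp only [contract, Set.mem_ofPred_eq]
    constructor
    · rintro ⟨_, ⟨f, hf, hfB, rfl⟩, hfe, rfl⟩
      refine ⟨f, hf, fun hs => hfe ?_, ?_⟩
      · rintro _ ⟨y, hy, rfl⟩
        exact (hmem y).2 (hs hy)
      · rw [Set.image_image]
        exact Set.image_congr fun y _ => hcomp y
    · rintro ⟨f, hf, hfB, rfl⟩
      refine ⟨_, ⟨f, hf, fun hs => hfB (hs.trans Set.subset_union_left), rfl⟩, fun hs => hfB ?_, ?_⟩
      · intro y hy
        exact (hmem y).1 (hs ⟨y, hy, rfl⟩)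
      · rw [Set.image_image]
        exact (Set.image_congr fun y _ => hcomp y).symm

lemma edge_contract_nontrivial (hH : ∀ e ∈ H.edgeSet, e.Nontrivial) {B : Set α} {v : α}
    (hv : v ∈ B) : ∀ e ∈ (H.contract B v).edgeSet, e.Nontrivial := by
  rintro _ ⟨f, hf, hfB, rfl⟩
  obtain ⟨y, hy, hyB⟩ := Set.not_subset.1 hfB
  obtain ⟨z, hz, hzy⟩ := (hH f hf).exists_ne y
  refine ⟨_, ⟨y, hy, rfl⟩, _, ⟨z, hz, rfl⟩, ?_⟩
  rw [contractMap_of_notMem hyB]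
  by_cases hzB : z ∈ B
  · rw [contractMap_of_mem hzB]
    rintro rfl
    exact hyB hv
  · rw [contractMap_of_notMem hzB]
    exact hzy.symm

/-- The hypergraph obtained by merging a contractible set is reached by contractions. -/
lemma IsContractible.reflTransGen_contract (hH : ∀ e ∈ H.edgeSet, e.Nontrivial) {B : Set α}
    (hB : H.IsContractible B) :
    ∃ v ∈ B, Relation.ReflTransGen MinorStep H (H.contract B v) := by
  induction hB with
  | singleton v hv => exact ⟨v, rfl, by rw [contract_singleton hH hv]⟩
  | union B e hB he h ih =>
    obtain ⟨v, hvB, hred⟩ := ih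
    refine ⟨v, Or.inl hvB, ?_⟩
    -- Such an `e` has already disappeared, so there is nothing left to contract.
    by_cases hs : e ⊆ B
    · rwa [Set.union_eq_self_of_subset_right hs]
    · rw [← contract_contract hvB h]
      have he' : contractMap B v '' e ∈ (H.contract B v).edgeSet := ⟨e, he, hs, rfl⟩
      refine hred.tail (MinorStep.contract _ _ he' _ fun hv => hv.2 ?_)
      obtain ⟨w, hwe, hwB⟩ := h
      exact ⟨w, hwe, contractMap_of_mem hwB⟩

/-- A family of disjoint contractible sets, any two of which are joined by a hyperedge inside their
union. -/
structure IsModel {ι : Type*} (H : Hypergraph α) (B : ι → Set α) : Prop where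
  contractible : ∀ i, H.IsContractible (B i)
  disjoint : ∀ i j, i ≠ j → Disjoint (B i) (B j)
  joined : ∀ i j, i ≠ j → ∃ e ∈ H.edgeSet, e ⊆ B i ∪ B j ∧ (e ∩ B i).Nonempty ∧ (e ∩ B j).Nonempty

lemma IsContractible.contract {A B : Set α} {v : α} (hA : H.IsContractible A)
    (h : Disjoint A B) : (H.contract B v).IsContractible A := by
  induction hA with
  | singleton w hw => exact .singleton w (Or.inl ⟨hw, Set.disjoint_singleton_left.1 h⟩)
  | union A e hA he hne ih =>
    rw [Set.disjoint_union_left] at h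
    refine .union A e (ih h.1) ⟨e, he, fun hs => ?_, (image_contractMap_of_disjoint v h.2).symm⟩ hne
    obtain ⟨x, hx, -⟩ := hne
    exact Set.disjoint_left.1 h.2 hx (hs hx)

-- Hyperedges joining `B i` to another member keep a vertex outside `B i` and so survive; those
-- joining two other members avoid `B i` and are unchanged.
open Classical in
lemma IsModel.contract {ι : Type*} {B : ι → Set α} (hB : H.IsModel B) (i : ι) {v : α}
    (hv : v ∈ B i) : (H.contract (B i) v).IsModel (Function.update B i {v}) := by
  have hdisj : ∀ j, j ≠ i → v ∉ B j := fun j hj hvj =>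
    Set.disjoint_left.1 (hB.disjoint j i hj) hvj hv
  have hjoin : ∀ j, j ≠ i → ∃ e ∈ (H.contract (B i) v).edgeSet,
      e ⊆ B j ∪ {v} ∧ (e ∩ B j).Nonempty ∧ (e ∩ {v}).Nonempty := by
    intro j hj
    obtain ⟨e, he, hs, ⟨x, hxe, hxj⟩, y, hye, hyi⟩ := hB.joined j i hj
    have hxi : x ∉ B i := Set.disjoint_left.1 (hB.disjoint j i hj) hxj
    refine ⟨_, ⟨e, he, fun hs' => hxi (hs' hxe), rfl⟩, ?_, ⟨x, ⟨x, hxe, contractMap_of_notMem hxi⟩,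
      hxj⟩, v, ⟨y, hye, contractMap_of_mem hyi⟩, rfl⟩
    rintro _ ⟨z, hz, rfl⟩
    by_cases hzi : z ∈ B i
    · exact Or.inr (contractMap_of_mem hzi)
    · rw [contractMap_of_notMem hzi]
      exact Or.inl ((hs hz).resolve_right hzi)
  refine ⟨fun j => ?_, fun j k hjk => ?_, fun j k hjk => ?_⟩
  · by_cases hj : j = i
    · subst hj
      rw [Function.update_self]
      exact .singleton v (Or.inr rfl)
    · simpa [hj] using (hB.contractible j).contract (hB.disjoint j i hj)
  · by_cases hj : j = i
    · subst hj
      simpa [hjk.symm] using hdisj k hjk.symm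
    · by_cases hk : k = i
      · subst hk
        simpa [hj] using hdisj j hj
      · simpa [hj, hk] using hB.disjoint j k hjk
  · by_cases hj : j = i
    · subst hj
      obtain ⟨e, he, hs, h1, h2⟩ := hjoin k hjk.symm
      refine ⟨e, he, ?_⟩
      rw [Function.update_self, Function.update_of_ne hjk.symm]
      exact ⟨by rwa [Set.union_comm], h2, h1⟩
    · by_cases hk : k = i
      · subst hk
        rw [Function.update_self, Function.update_of_ne hj]
        exact hjoin j hj
      · rw [Function.update_of_ne hj, Function.update_of_ne hk]
        obtain ⟨e, he, hs, h1, h2⟩ := hB.joined j k hjk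
        have hd : Disjoint e (B i) := by
          refine Set.disjoint_of_subset_left hs (Set.disjoint_union_left.2 ?_)
          exact ⟨hB.disjoint j i hj, hB.disjoint k i hk⟩
        refine ⟨e, ⟨e, he, fun hs' => ?_, (image_contractMap_of_disjoint v hd).symm⟩, hs, h1, h2⟩
        obtain ⟨x, hx, -⟩ := h1
        exact Set.disjoint_left.1 hd hx (hs' hx)

/-- Merging the members of a model one after another. -/
lemma IsModel.exists_singletons {ι : Type*} {B : ι → Set α}
    (hH : ∀ e ∈ H.edgeSet, e.Nontrivial) (hB : H.IsModel B) (S : Finset ι) :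
    ∃ (H' : Hypergraph α) (B' : ι → Set α), Relation.ReflTransGen MinorStep H H' ∧
      (∀ e ∈ H'.edgeSet, e.Nontrivial) ∧ H'.IsModel B' ∧ ∀ i ∈ S, ∃ v, B' i = {v} := by
  classical
  induction S using Finset.induction_on with
  | empty => exact ⟨H, B, .refl, hH, hB, by simp⟩
  | insert i S _ ih =>
    obtain ⟨H', B', hred, hH', hB', hS⟩ := ih
    obtain ⟨v, hv, hred'⟩ := (hB'.contractible i).reflTransGen_contract hH'
    refine ⟨_, _, hred.trans hred', edge_contract_nontrivial hH' hv, hB'.contract i hv, ?_⟩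
    intro j hj
    by_cases hji : j = i
    · subst hji
      exact ⟨v, by simp⟩
    · rw [Function.update_of_ne hji]
      exact hS j ((Finset.mem_insert.1 hj).resolve_left hji)

/-- Once all members are singletons, a joining hyperedge can only be the pair itself; a
subhypergraph then discards everything else. -/
lemma IsModel.isMinor {t : ℕ} {B : Fin t → Set α} (hH : ∀ e ∈ H.edgeSet, e.Nontrivial)
    (hB : H.IsModel B) : (completeGraph t).IsMinor H := by
  obtain ⟨H', B', hred, hH', hB', hS⟩ := hB.exists_singletons hH Finset.univ
  choose v hv using fun i => hS i (Finset.mem_univ i)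
  have hinj : Function.Injective v := by
    intro i j hij
    by_contra hne
    have := hB'.disjoint i j hne
    rw [hv, hv, hij] at this
    simp at this
  have hedge : ∀ i j, i ≠ j → ({v i, v j} : Set α) ∈ H'.edgeSet := by
    intro i j hij
    obtain ⟨e, he, hs, ⟨x, hx, hxi⟩, y, hy, hyj⟩ := hB'.joined i j hij
    rw [hv] at hxi hyj
    rw [hv, hv] at hs
    obtain rfl := hxi
    obtain rfl := hyj
    have : e = {v i, v j} := by
      refine Set.Subset.antisymm hs ?_
      rintro z (rfl | rfl) <;> assumption
    rwa [← this]
  have hvert : ∀ i, v i ∈ H'.vertexSet := fun i =>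
    (hB'.contractible i).subset (by rw [hv]; rfl)
  let K : Hypergraph α :=
    { vertexSet := Set.range v
      edgeSet := {e | ∃ i j, i ≠ j ∧ e = {v i, v j}}
      subset_vertexSet_of_mem_edgeSet' := by
        rintro _ ⟨i, j, -, rfl⟩ x (rfl | rfl) <;> exact ⟨_, rfl⟩ }
  refine ⟨K, hred.tail (.sub _ _ ⟨?_, ?_⟩), ?_⟩
  · rintro _ ⟨i, rfl⟩
    exact hvert i
  · rintro _ ⟨i, j, hij, rfl⟩
    exact hedge i j hij
  · let φ : (completeGraph t).vertexSet ≃ K.vertexSet :=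
      (Equiv.Set.univ _).trans (Equiv.ofInjective v hinj)
    refine ⟨φ, fun f => ?_⟩
    have himg : Subtype.val '' (φ '' f) = v '' (Subtype.val '' f) := by
      ext x
      simp only [Set.mem_image, exists_exists_and_eq_and]
      rfl
    rw [himg]
    change (Subtype.val '' f).encard = 2 ↔ ∃ i j, i ≠ j ∧ v '' (Subtype.val '' f) = {v i, v j}
    rw [Set.encard_eq_two]
    refine exists_congr fun i => exists_congr fun j => and_congr_right fun _ => ?_
    rw [← Set.image_pair, hinj.image_injective.eq_iff]

end Hypergraph
-- Tutte's theorem with universal vertices added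
namespace SimpleGraph

universe u

variable {β : Type u}

/-- The graph obtained from `G` by adding `d` vertices adjacent to all other vertices. -/
def addUniversal (G : SimpleGraph β) (d : ℕ) : SimpleGraph (β ⊕ Fin d) where
  Adj a b := a ≠ b ∧ ∀ x y, a = .inl x → b = .inl y → G.Adj x y
  symm := ⟨fun _ _ h => ⟨h.1.symm, fun x y hx hy => (h.2 y x hy hx).symm⟩⟩
  loopless := ⟨fun _ h => h.1 rfl⟩

/-- If a graph with `d` universal vertices added has no perfect matching, then there is a set `W` of
vertices of the original graph for which the labelling `f` by components takes many values. -/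
lemma exists_many_components [Finite β] (G : SimpleGraph β) (d : ℕ)
    (heven : Even (Nat.card β + d)) (h : ∀ M : (G.addUniversal d).Subgraph, ¬ M.IsPerfectMatching) :
    ∃ (ι : Type u) (W : Finset β) (f : β → ι), (∀ x ∈ W, ∀ y ∈ W, f x ≠ f y → ¬ G.Adj x y) ∧
      Nat.card β + d + 2 ≤ W.card + (f '' W).ncard := by
  classical
  have := Fintype.ofFinite β
  obtain ⟨u, hu⟩ : ∃ u, (G.addUniversal d).IsTutteViolator u := by
    by_contra! hcon
    obtain ⟨M, hM⟩ := tutte.2 hcon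
    exact h M hM
  unfold IsTutteViolator at hu
  set T := ((⊤ : (G.addUniversal d).Subgraph).deleteVerts u) with hT
  have hmem : ∀ a, a ∈ T.verts ↔ a ∉ u := by simp [hT]
  have hcard : Nat.card T.verts + u.ncard = Nat.card β + d := by
    have h1 : T.verts = uᶜ := Set.ext hmem
    rw [h1, Nat.card_coe_set_eq, add_comm, Set.ncard_add_ncard_compl]
    simp
  -- The number of odd components has the parity of `|T|`, hence of `|u|`, so Tutte's strict
  -- inequality gains one more.
  have hparity := T.coe.odd_ncard_oddComponents
  have hle : u.ncard + 2 ≤ T.coe.oddComponents.ncard := by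
    rw [Nat.odd_iff, Nat.odd_iff] at hparity
    rw [Nat.even_iff] at heven
    omega
  have hadj : ∀ a b (ha : a ∈ T.verts) (hb : b ∈ T.verts), (G.addUniversal d).Adj a b →
      T.coe.Adj ⟨a, ha⟩ ⟨b, hb⟩ := by
    intro a b ha hb hab
    simpa [hT, (hmem _).1 ha, (hmem _).1 hb] using hab
  -- A surviving universal vertex would make `T` connected, but there are at least two odd
  -- components.
  have hsub : ∀ i : Fin d, Sum.inr i ∈ u := by
    intro i
    by_contra hi
    have hi' := (hmem _).2 hi
    have hall : ∀ c : T.coe.ConnectedComponent, c = T.coe.connectedComponentMk ⟨_, hi'⟩ := by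
      intro c
      induction c using ConnectedComponent.ind with
      | h a =>
        obtain ⟨a, ha⟩ := a
        rw [ConnectedComponent.eq]
        by_cases hai : a = Sum.inr i
        · subst hai
          exact Reachable.refl _
        · refine (hadj a _ ha hi' ⟨hai, ?_⟩).reachable
          intro x y _ hy
          simp at hy
    have hone : T.coe.oddComponents.ncard ≤ 1 := by
      rw [Set.ncard_le_one_iff]
      intro a b _ _
      rw [hall a, hall b]
    omega
  let W : Finset β := Finset.univ.filter fun x => Sum.inl x ∉ u
  -- The value `none` is never taken on `W`.
  let f : β → Option T.coe.ConnectedComponent := fun x =>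
    if hx : Sum.inl x ∈ T.verts then some (T.coe.connectedComponentMk ⟨_, hx⟩) else none
  have hf : ∀ x (hx : Sum.inl x ∈ T.verts), f x = some (T.coe.connectedComponentMk ⟨_, hx⟩) :=
    fun x hx => dif_pos hx
  refine ⟨_, W, f, ?_, ?_⟩
  · intro x hx y hy hne hxy
    have hx' : Sum.inl x ∈ T.verts := (hmem _).2 (by simpa [W] using hx)
    have hy' : Sum.inl y ∈ T.verts := (hmem _).2 (by simpa [W] using hy)
    apply hne
    rw [hf x hx', hf y hy', Option.some_inj, ConnectedComponent.eq]
    refine (hadj _ _ hx' hy' ⟨by simpa using hxy.ne, ?_⟩).reachable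
    intro a b ha hb
    cases ha
    cases hb
    exact hxy
  · have hW : Nat.card T.verts = W.card := by
      have : T.verts = Sum.inl '' (W : Set β) := by
        ext a
        rw [hmem]
        cases a with
        | inl x => simp [W]
        | inr i => simp [hsub i]
      rw [this, Nat.card_coe_set_eq, Set.ncard_image_of_injective _ Sum.inl_injective,
        Set.ncard_coe_finset]
    have hcomp : T.coe.oddComponents.ncard ≤ (f '' W).ncard := by
      rw [← Set.ncard_image_of_injective _ (Option.some_injective _)]
      refine Set.ncard_le_ncard ?_ (Set.toFinite _)
      rintro _ ⟨c, -, rfl⟩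
      induction c using ConnectedComponent.ind with
      | h a =>
        obtain ⟨a, ha⟩ := a
        cases a with
        | inl x =>
          refine ⟨x, ?_, hf x ha⟩
          simpa [W] using (hmem _).1 ha
        | inr i => exact absurd (hsub i) ((hmem _).1 ha)
    omega

/-- A perfect matching partitions the vertices into pairs. -/
lemma Subgraph.IsPerfectMatching.exists_labelling {V : Type*} [Finite V] {G : SimpleGraph V}
    {M : G.Subgraph} (hM : M.IsPerfectMatching) {k : ℕ} (hk : Nat.card V = 2 * k) :
    ∃ c : V → Fin k, (∀ x y, c x = c y → x = y ∨ G.Adj x y) ∧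
      ∀ x y z, c x = c y → c x = c z → x = y ∨ x = z ∨ y = z := by
  classical
  have := Fintype.ofFinite V
  have hv : ∀ x, x ∈ M.verts := fun x => hM.2 x
  have hdeg : ∀ x, M.spanningCoe.degree x = 1 := by
    intro x
    rw [Subgraph.degree_spanningCoe]
    exact (Subgraph.isPerfectMatching_iff_forall_degree.1 hM) x
  have hsum := M.spanningCoe.sum_degrees_eq_twice_card_edges
  simp only [hdeg, Finset.sum_const, smul_eq_mul, mul_one, Finset.card_univ] at hsum
  have hcard : Nat.card M.edgeSet = k := by
    rw [← Nat.card_eq_fintype_card, hk] at hsum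
    have h2 : M.spanningCoe.edgeFinset.card = k := by omega
    rw [← h2, Nat.card_coe_set_eq, ← Set.ncard_coe_finset]
    congr 1
    ext e
    induction e with | _ a b => simp
  have hM' : ∀ x y, hM.1.toEdge ⟨x, hv x⟩ = hM.1.toEdge ⟨y, hv y⟩ → x = y ∨ M.Adj x y := by
    intro x y hxy
    have hx := hM.1.mem_coe_toEdge (hv x)
    have hy := hM.1.mem_coe_toEdge (hv y)
    rw [hxy] at hx
    by_cases hne : x = y
    · exact Or.inl hne
    · right
      have he := (hM.1.toEdge ⟨y, hv y⟩).2
      rwa [(Sym2.mem_and_mem_iff hne).1 ⟨hx, hy⟩] at he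
  have hinj := (Finite.equivFinOfCardEq hcard).injective
  refine ⟨fun x => Finite.equivFinOfCardEq hcard (hM.1.toEdge ⟨x, hv x⟩),
    fun x y hxy => (hM' x y (hinj hxy)).imp_right M.adj_sub, fun x y z hxy hxz => ?_⟩
  rcases hM' x y (hinj hxy) with h | h
  · exact Or.inl h
  rcases hM' x z (hinj hxz) with h' | h'
  · exact Or.inr (Or.inl h')
  · exact Or.inr (Or.inr (hM.1.eq_of_adj_left h h'))

end SimpleGraph
-- Large models when every three vertices span a hyperedge
namespace Hypergraph

variable {α : Type*} {H : Hypergraph α}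

lemma IsContractible.of_mem_edgeSet {e : Set α} (he : e ∈ H.edgeSet) (hne : e.Nonempty) :
    H.IsContractible e := by
  obtain ⟨x, hx⟩ := hne
  have h := IsContractible.union {x} e (.singleton x (H.subset_vertexSet_of_mem_edgeSet' he hx)) he
    ⟨x, hx, rfl⟩
  rwa [Set.union_eq_self_of_subset_left (Set.singleton_subset_iff.2 hx)] at h

lemma eq_of_nontrivial_of_subset_triple {e : Set α} {x y z : α} (he : e.Nontrivial)
    (hs : e ⊆ {x, y, z}) : e = {x, y} ∨ e = {x, z} ∨ e = {y, z} ∨ e = {x, y, z} := by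
  obtain ⟨a, ha, b, hb, hab⟩ := he
  have hs' : ∀ c ∈ e, c = x ∨ c = y ∨ c = z := fun c hc => by simpa using hs hc
  by_cases hx : x ∈ e <;> by_cases hy : y ∈ e <;> by_cases hz : z ∈ e
  · right; right; right
    exact Set.Subset.antisymm hs (by rintro c (rfl | rfl | rfl) <;> assumption)
  · left
    ext c; simp only [Set.mem_insert_iff, Set.mem_singleton_iff]; grind
  · right; left
    ext c; simp only [Set.mem_insert_iff, Set.mem_singleton_iff]; grind
  · grind
  · right; right; left
    ext c; simp only [Set.mem_insert_iff, Set.mem_singleton_iff]; grind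
  all_goals grind

/-- `H` has a model of `K_k` inside `W`. -/
def HasModel (H : Hypergraph α) (W : Set α) (k : ℕ) : Prop :=
  ∃ B : Fin k → Set α, H.IsModel B ∧ ∀ i, B i ⊆ W

lemma HasModel.mono {W W' : Set α} {k k' : ℕ} (h : H.HasModel W k) (hW : W ⊆ W') (hk : k' ≤ k) :
    H.HasModel W' k' := by
  obtain ⟨B, hB, hs⟩ := h
  have hinj := Fin.castLE_injective hk
  exact ⟨fun i => B (Fin.castLE hk i), ⟨fun i => hB.contractible _,
    fun i j hij => hB.disjoint _ _ (hinj.ne hij), fun i j hij => hB.joined _ _ (hinj.ne hij)⟩,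
    fun i => (hs _).trans hW⟩

lemma hasModel_zero (W : Set α) : H.HasModel W 0 :=
  ⟨Fin.elim0, ⟨fun i => i.elim0, fun i => i.elim0, fun i => i.elim0⟩, fun i => i.elim0⟩

/-- A contractible set `D` that dominates the rest of `W` can be split off as a new member: any
vertex of another member provides the joining hyperedge. -/
lemma HasModel.succ (hH : ∀ e ∈ H.edgeSet, e.Nontrivial) {W D : Set α} {k : ℕ}
    (h : H.HasModel (W \ D) k) (hD : H.IsContractible D) (hDW : D ⊆ W)
    (hdom : ∀ x ∈ W, x ∉ D → ∃ e ∈ H.edgeSet, x ∈ e ∧ e ⊆ insert x D) : H.HasModel W (k + 1) := by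
  obtain ⟨B, hB, hs⟩ := h
  have hdisj : ∀ i, Disjoint (B i) D := fun i =>
    Set.disjoint_of_subset_left (hs i) Set.disjoint_sdiff_left
  have hjoin : ∀ i, ∃ e ∈ H.edgeSet, e ⊆ B i ∪ D ∧ (e ∩ B i).Nonempty ∧ (e ∩ D).Nonempty := by
    intro i
    obtain ⟨x, hx⟩ := (hB.contractible i).nonempty
    obtain ⟨e, he, hxe, hsub⟩ := hdom x (hs i hx).1 (hs i hx).2
    obtain ⟨y, hy, hyx⟩ := (hH e he).exists_ne x
    refine ⟨e, he, hsub.trans ?_, ⟨x, hxe, hx⟩, y, hy, (hsub hy).resolve_left hyx⟩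
    rintro z (rfl | hz)
    exacts [Or.inl hx, Or.inr hz]
  refine ⟨Fin.cons D B, ⟨fun i => ?_, fun i j => ?_, fun i j => ?_⟩, fun i => ?_⟩
  · cases i using Fin.cases with
    | zero => exact hD
    | succ i => exact hB.contractible i
  · cases i using Fin.cases with
    | zero =>
      cases j using Fin.cases with
      | zero => exact fun h => absurd rfl h
      | succ j => exact fun _ => (hdisj j).symm
    | succ i =>
      cases j using Fin.cases with
      | zero => exact fun _ => hdisj i
      | succ j => exact fun hij => hB.disjoint i j (fun h => hij (congrArg _ h))
  · cases i using Fin.cases with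
    | zero =>
      cases j using Fin.cases with
      | zero => exact fun h => absurd rfl h
      | succ j =>
        intro _
        obtain ⟨e, he, h1, h2, h3⟩ := hjoin j
        exact ⟨e, he, by simpa [Set.union_comm] using h1, h3, h2⟩
    | succ i =>
      cases j using Fin.cases with
      | zero => exact fun _ => hjoin i
      | succ j => exact fun hij => hB.joined i j (fun h => hij (congrArg _ h))
  · cases i using Fin.cases with
    | zero => exact hDW
    | succ i => exact (hs i).trans Set.sdiff_subset

lemma hasModel_of_clique (hH : ∀ e ∈ H.edgeSet, e.Nontrivial) (W : Finset α)
    (hW : ↑W ⊆ H.vertexSet) (hcl : ∀ x ∈ W, ∀ y ∈ W, x ≠ y → {x, y} ∈ H.edgeSet) :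
    H.HasModel W W.card := by
  classical
  induction W using Finset.induction_on with
  | empty => exact hasModel_zero _
  | insert v W hv ih =>
    rw [Finset.card_insert_of_notMem hv]
    refine HasModel.succ hH (D := {v}) ?_ (.singleton v (hW (by simp))) (by simp) ?_
    · have := ih (fun x hx => hW (by simp [Finset.mem_coe.1 hx])) fun x hx y hy =>
        hcl x (by simp [hx]) y (by simp [hy])
      refine this.mono ?_ le_rfl
      intro x hx
      refine ⟨by simp [Finset.mem_coe.1 hx], ?_⟩
      rintro rfl
      exact hv hx
    · intro x hx hxv
      exact ⟨{x, v}, hcl x hx v (by simp) hxv, by simp, subset_rfl⟩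

/-- Every three vertices span a hyperedge. -/
def TriplesSpan (H : Hypergraph α) : Prop :=
  ∀ x ∈ H.vertexSet, ∀ y ∈ H.vertexSet, ∀ z ∈ H.vertexSet, x ≠ y → x ≠ z → y ≠ z →
    ∃ e ∈ H.edgeSet, e ⊆ {x, y, z}

lemma triplesSpan_of_independenceNumber_le (h : H.independenceNumber ≤ 2) : H.TriplesSpan := by
  intro x hx y hy z hz hxy hxz hyz
  by_contra! hcon
  have hind : H.IsIndependent {x, y, z} :=
    ⟨by rintro a (rfl | rfl | rfl) <;> assumption, hcon⟩
  have h3 : ({x, y, z} : Set α).encard ≤ 2 :=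
    (le_iSup₂ (f := fun (W : Set α) (_ : H.IsIndependent W) => W.encard) _ hind).trans h
  rw [Set.encard_eq_three.2 ⟨x, y, z, hxy, hxz, hyz, rfl⟩] at h3
  exact absurd h3 (by decide)

/-- A set containing a pair that is not a hyperedge dominates all vertices. -/
lemma TriplesSpan.exists_edge (hH : ∀ e ∈ H.edgeSet, e.Nontrivial) (hT : H.TriplesSpan) {D : Set α}
    {u w x : α} (hu : u ∈ D) (hw : w ∈ D) (hD : D ⊆ H.vertexSet) (huw : u ≠ w)
    (hnadj : {u, w} ∉ H.edgeSet) (hx : x ∈ H.vertexSet) (hxD : x ∉ D) :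
    ∃ e ∈ H.edgeSet, x ∈ e ∧ e ⊆ insert x D := by
  have hxu : x ≠ u := by rintro rfl; exact hxD hu
  have hxw : x ≠ w := by rintro rfl; exact hxD hw
  obtain ⟨e, he, hs⟩ := hT x hx u (hD hu) w (hD hw) hxu hxw huw
  refine ⟨e, he, ?_, hs.trans ?_⟩
  · rcases eq_of_nontrivial_of_subset_triple (hH e he) hs with rfl | rfl | rfl | rfl
    · simp
    · simp
    · exact absurd he hnadj
    · simp
  · rintro a (rfl | rfl | rfl)
    exacts [Or.inl rfl, Or.inr hu, Or.inr hw]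

/-- The Duchet–Meyniel bound for hypergraphs with independence number at most two. -/
lemma TriplesSpan.exists_hasModel (hH : ∀ e ∈ H.edgeSet, e.Nontrivial) (hT : H.TriplesSpan)
    (W : Finset α) (hW : ↑W ⊆ H.vertexSet) : ∃ k, H.HasModel W k ∧ W.card ≤ 3 * k := by
  classical
  induction W using Finset.strongInduction with
  | H W ih =>
  have step : ∀ D : Finset α, H.IsContractible D → D ⊆ W → D.card ≤ 3 →
      (∃ u ∈ D, ∃ w ∈ D, u ≠ w ∧ {u, w} ∉ H.edgeSet) → ∃ k, H.HasModel W k ∧ W.card ≤ 3 * k := by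
    rintro D hD hDW hcard ⟨u, hu, w, hw, huw, hnadj⟩
    obtain ⟨k, hk, hle⟩ := ih (W \ D) (Finset.sdiff_ssubset hDW ⟨u, hu⟩)
      (fun x hx => hW (Finset.mem_sdiff.1 hx).1)
    rw [Finset.coe_sdiff] at hk
    refine ⟨k + 1, hk.succ hH hD (by exact_mod_cast hDW) fun x hx hxD =>
      hT.exists_edge hH hu hw hD.subset huw hnadj (hW hx) hxD, ?_⟩
    have := Finset.card_sdiff_add_card_eq_card hDW
    omega
  -- An induced path `u`, `v`, `w`: contractible through `v`, and dominating because `{u, w}` is not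
  -- a hyperedge.
  by_cases hP : ∃ v ∈ W, ∃ u ∈ W, ∃ w ∈ W, u ≠ w ∧ {v, u} ∈ H.edgeSet ∧ {v, w} ∈ H.edgeSet ∧
      {u, w} ∉ H.edgeSet
  · obtain ⟨v, hv, u, hu, w, hw, huw, h1, h2, h3⟩ := hP
    refine step {v, u, w} ?_ ?_ Finset.card_le_three ⟨u, by simp, w, by simp, huw, h3⟩
    · have := IsContractible.union _ {v, w} (IsContractible.of_mem_edgeSet h1 ⟨v, by simp⟩) h2
        ⟨v, by simp, by simp⟩
      convert this using 1
      ext x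
      simp
      tauto
    · intro x hx
      simp only [Finset.mem_insert, Finset.mem_singleton] at hx
      rcases hx with rfl | rfl | rfl <;> assumption
  -- If no two of the three form a hyperedge, the triple itself must be one.
  by_cases hI : ∃ v ∈ W, ∃ u ∈ W, ∃ w ∈ W, v ≠ u ∧ v ≠ w ∧ u ≠ w ∧ {v, u} ∉ H.edgeSet ∧
      {v, w} ∉ H.edgeSet ∧ {u, w} ∉ H.edgeSet
  · obtain ⟨v, hv, u, hu, w, hw, hvu, hvw, huw, h1, h2, h3⟩ := hI
    refine step {v, u, w} ?_ ?_ Finset.card_le_three ⟨u, by simp, w, by simp, huw, h3⟩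
    · obtain ⟨e, he, hs⟩ := hT v (hW hv) u (hW hu) w (hW hw) hvu hvw huw
      have hc := IsContractible.of_mem_edgeSet he (hH e he).nonempty
      rcases eq_of_nontrivial_of_subset_triple (hH e he) hs with rfl | rfl | rfl | rfl
      · exact absurd he h1
      · exact absurd he h2
      · exact absurd he h3
      · simpa using hc
    · intro x hx
      simp only [Finset.mem_insert, Finset.mem_singleton] at hx
      rcases hx with rfl | rfl | rfl <;> assumption
  push Not at hP hI
  rcases W.eq_empty_or_nonempty with rfl | ⟨v, hv⟩
  · exact ⟨0, hasModel_zero _, by simp⟩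
  -- Now being joined by a pair is transitive on `W`, with at most two classes: `N` and `M` are
  -- cliques, and the larger has at least half of `W`.
  let N := W.filter fun x => x = v ∨ {v, x} ∈ H.edgeSet
  let M := W.filter fun x => ¬ (x = v ∨ {v, x} ∈ H.edgeSet)
  have hNM : N.card + M.card = W.card := Finset.card_filter_add_card_filter_not _
  have hNW : (N : Set α) ⊆ W := by exact_mod_cast Finset.filter_subset _ _
  have hMW : (M : Set α) ⊆ W := by exact_mod_cast Finset.filter_subset _ _
  have hN : H.HasModel W N.card := by
    refine (hasModel_of_clique hH N (hNW.trans hW) ?_).mono hNW le_rfl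
    intro x hx y hy hxy
    obtain ⟨hxW, hx⟩ := Finset.mem_filter.1 hx
    obtain ⟨hyW, hy⟩ := Finset.mem_filter.1 hy
    rcases hx with rfl | hx
    · exact hy.resolve_left hxy.symm
    rcases hy with rfl | hy
    · rwa [Set.pair_comm]
    · exact hP v hv x hxW y hyW hxy hx hy
  have hM : H.HasModel W M.card := by
    refine (hasModel_of_clique hH M (hMW.trans hW) ?_).mono hMW le_rfl
    intro x hx y hy hxy
    obtain ⟨hxW, hx⟩ := Finset.mem_filter.1 hx
    obtain ⟨hyW, hy⟩ := Finset.mem_filter.1 hy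
    push Not at hx hy
    exact hI v hv x hxW y hyW hx.1.symm hy.1.symm hxy hx.2 hy.2
  rcases le_total N.card M.card with h | h
  · exact ⟨_, hM, by omega⟩
  · exact ⟨_, hN, by omega⟩

/-- If the vertices of `W` are labelled such that differently labelled vertices are adjacent, then
the bound on the size of a model improves with the number of labels. -/
lemma TriplesSpan.exists_hasModel_of_labelling (hH : ∀ e ∈ H.edgeSet, e.Nontrivial)
    (hT : H.TriplesSpan) {ι : Type*} [DecidableEq ι] (f : α → ι) (W : Finset α)
    (hW : ↑W ⊆ H.vertexSet) (hf : ∀ x ∈ W, ∀ y ∈ W, f x ≠ f y → {x, y} ∈ H.edgeSet) :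
    ∃ k, H.HasModel W k ∧ W.card + (W.image f).card ≤ 3 * k + 1 := by
  classical
  induction W using Finset.strongInduction with
  | H W ih =>
  have step : ∀ D : Finset α, D.Nonempty → H.IsContractible D → D ⊆ W →
      (∀ x ∈ W, x ∉ D → ∃ e ∈ H.edgeSet, x ∈ e ∧ e ⊆ insert x D) →
      W.card + (W.image f).card ≤ (W \ D).card + ((W \ D).image f).card + 3 →
      ∃ k, H.HasModel W k ∧ W.card + (W.image f).card ≤ 3 * k + 1 := by
    intro D hne hD hDW hdom hcard
    have hsub : W \ D ⊆ W := Finset.sdiff_subset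
    obtain ⟨k, hk, hle⟩ := ih (W \ D) (Finset.sdiff_ssubset hDW hne)
      (fun x hx => hW (hsub hx)) (fun x hx y hy => hf x (hsub hx) y (hsub hy))
    rw [Finset.coe_sdiff] at hk
    exact ⟨k + 1, hk.succ hH hD (by exact_mod_cast hDW) hdom, by omega⟩
  have himage : ∀ (S : Finset α) (x : α), (S.image f).card ≤ ((S.erase x).image f).card + 1 := by
    intro S x
    refine (Finset.card_le_card ?_).trans (Finset.card_insert_le (f x) _)
    intro a ha
    obtain ⟨y, hy, rfl⟩ := Finset.mem_image.1 ha
    by_cases hyx : y = x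
    · simp [hyx]
    · exact Finset.mem_insert_of_mem (Finset.mem_image_of_mem f (Finset.mem_erase.2 ⟨hyx, hy⟩))
  -- The `+ 1` in the bound absorbs a single label.
  by_cases hc : (W.image f).card ≤ 1
  · obtain ⟨k, hk, hle⟩ := hT.exists_hasModel hH W hW
    exact ⟨k, hk, by omega⟩
  obtain ⟨_, ha, _, hb, hab⟩ := Finset.one_lt_card.1 (not_le.1 hc)
  obtain ⟨x, hx, rfl⟩ := Finset.mem_image.1 ha
  obtain ⟨y, hy, rfl⟩ := Finset.mem_image.1 hb
  have hxy : x ≠ y := fun h => hab (congrArg f h)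
  -- If the label of `x` is repeated, remove `{x, y}`: every vertex differs in label from `x` or
  -- `y`, and at most the label of `y` is lost. Otherwise `{x}` alone dominates, costing one vertex
  -- and one label.
  by_cases hz : ∃ z ∈ W, z ≠ x ∧ f z = f x
  · obtain ⟨z, hz, hzx, hfz⟩ := hz
    have hDW : ({x, y} : Finset α) ⊆ W := by
      intro a ha
      simp only [Finset.mem_insert, Finset.mem_singleton] at ha
      rcases ha with rfl | rfl <;> assumption
    refine step {x, y} ⟨x, by simp⟩ ?_ hDW ?_ ?_
    · rw [Finset.coe_pair]
      exact .of_mem_edgeSet (hf x hx y hy hab) ⟨x, by simp⟩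
    · intro w hw hwD
      by_cases hwx : f w = f x
      · refine ⟨{w, y}, hf w hw y hy (by rwa [hwx]), by simp, ?_⟩
        rintro a (rfl | rfl) <;> simp
      · refine ⟨{w, x}, hf w hw x hx hwx, by simp, ?_⟩
        rintro a (rfl | rfl) <;> simp
    · have h1 := Finset.card_sdiff_add_card_eq_card hDW
      rw [Finset.card_pair hxy] at h1
      have h2 : W.image f = (W.erase x).image f := by
        refine Finset.Subset.antisymm ?_ (Finset.image_subset_image (Finset.erase_subset _ _))
        intro a ha
        obtain ⟨w, hw, rfl⟩ := Finset.mem_image.1 ha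
        by_cases hwx : w = x
        · rw [hwx, ← hfz]
          exact Finset.mem_image_of_mem f (Finset.mem_erase.2 ⟨hzx, hz⟩)
        · exact Finset.mem_image_of_mem f (Finset.mem_erase.2 ⟨hwx, hw⟩)
      have h3 := himage (W.erase x) y
      have h4 : (W.erase x).erase y = W \ {x, y} := by
        ext a
        simp only [Finset.mem_erase, Finset.mem_sdiff, Finset.mem_insert, Finset.mem_singleton]
        tauto
      rw [h4, ← h2] at h3
      omega
  · push Not at hz
    refine step {x} ⟨x, by simp⟩ ?_ (by simpa using hx) ?_ ?_
    · rw [Finset.coe_singleton]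
      exact .singleton x (hW hx)
    · intro w hw hwx
      have hwx' : w ≠ x := by simpa using hwx
      exact ⟨{w, x}, hf w hw x hx (hz w hw hwx'), by simp, by simp⟩
    · have h1 := Finset.card_sdiff_add_card_eq_card (Finset.singleton_subset_iff.2 hx)
      rw [Finset.card_singleton] at h1
      have h3 := himage W x
      rw [Finset.erase_eq] at h3
      omega

/-! ### Colorings from matchings, and the conclusion -/

lemma chromaticNumber_le {k : ℕ} (c : H.vertexSet → Fin k) (hc : H.IsProperColoring c) :
    H.chromaticNumber ≤ k :=
  iInf₂_le (f := fun (k : ℕ) (_ : ∃ c : H.vertexSet → Fin k, H.IsProperColoring c) => (k : ℕ∞)) k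
    ⟨c, hc⟩

/-- The graph whose edges are the pairs of vertices that are not hyperedges. -/
def nonedgeGraph (H : Hypergraph α) : SimpleGraph H.vertexSet where
  Adj x y := x ≠ y ∧ ({x.1, y.1} : Set α) ∉ H.edgeSet
  symm := ⟨fun x y h => ⟨h.1.symm, by rw [Set.pair_comm]; exact h.2⟩⟩
  loopless := ⟨fun _ h => h.1 rfl⟩

/-- A class has at most two vertices, so a hyperedge inside it would be the whole class, which is a
pair that is not a hyperedge. -/
lemma isProperColoring_of_nonedgeGraph (hH : ∀ e ∈ H.edgeSet, e.Nontrivial) {d k : ℕ}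
    (c : H.vertexSet ⊕ Fin d → Fin k)
    (hinj : ∀ x y, c x = c y → x = y ∨ (H.nonedgeGraph.addUniversal d).Adj x y)
    (hthree : ∀ x y z, c x = c y → c x = c z → x = y ∨ x = z ∨ y = z) :
    H.IsProperColoring fun x => c (.inl x) := by
  intro s
  refine ⟨by rintro _ ⟨x, -, rfl⟩; exact x.2, fun e he hs => ?_⟩
  obtain ⟨_, ha, _, hb, hab⟩ := hH e he
  obtain ⟨x, hx, rfl⟩ := hs ha
  obtain ⟨y, hy, rfl⟩ := hs hb
  have hx : c (.inl x) = s := hx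
  have hy : c (.inl y) = s := hy
  have hxy : x ≠ y := fun h => hab (congrArg _ h)
  rcases hinj _ _ (hx.trans hy.symm) with h | h
  · exact hxy (Sum.inl_injective h)
  · refine (h.2 x y rfl rfl).2 ?_
    convert he using 1
    refine Set.Subset.antisymm (by rintro _ (rfl | rfl) <;> assumption) ?_
    intro z hze
    obtain ⟨z, hz, rfl⟩ := hs hze
    have hz : c (.inl z) = s := hz
    rcases hthree _ _ _ (hx.trans hy.symm) (hx.trans hz.symm) with h | h | h
    · exact absurd (Sum.inl_injective h) hxy
    · rw [Sum.inl_injective h]; exact Or.inl rfl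
    · rw [Sum.inl_injective h]; exact Or.inr rfl

/-- A hypergraph in which every three vertices span a hyperedge has at most `k` colours or a model
of a complete graph on more than `2 * k / 3` vertices. -/
lemma TriplesSpan.chromaticNumber_le_or_hasModel (hH : ∀ e ∈ H.edgeSet, e.Nontrivial)
    (hT : H.TriplesSpan) (hfin : H.vertexSet.Finite) (k : ℕ) :
    H.chromaticNumber ≤ k ∨ ∃ m, 2 * k < 3 * m ∧ H.HasModel H.vertexSet m := by
  classical
  have := hfin.to_subtype
  have hcard : Nat.card H.vertexSet = hfin.toFinset.card := by
    rw [Nat.card_coe_set_eq, Set.ncard_eq_toFinset_card _ hfin]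
  rcases lt_or_ge (2 * k) (Nat.card H.vertexSet) with hlt | hge
  · right
    obtain ⟨m, hm, hle⟩ := hT.exists_hasModel hH hfin.toFinset (by simp)
    exact ⟨m, by omega, by simpa using hm⟩
  obtain ⟨d, hd⟩ := Nat.exists_eq_add_of_le hge
  by_cases hM : ∃ M : (H.nonedgeGraph.addUniversal d).Subgraph, M.IsPerfectMatching
  · left
    obtain ⟨M, hM⟩ := hM
    obtain ⟨c, hc, hthree⟩ := hM.exists_labelling (k := k) (by simp [hd])
    exact chromaticNumber_le _ (isProperColoring_of_nonedgeGraph hH c hc hthree)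
  · right
    push Not at hM
    obtain ⟨ι, W, f, hf, hle⟩ :=
      SimpleGraph.exists_many_components _ d ⟨k, by omega⟩ hM
    -- The labels are extended to all of `α`; the default `none` lies outside the set considered.
    let g : α → Option ι := Function.extend Subtype.val (fun x => some (f x)) fun _ => none
    have hg : ∀ x : H.vertexSet, g x = some (f x) := Subtype.val_injective.extend_apply _ _
    have himg : (W.map (.subtype _)).image g = (W.image f).image some := by
      rw [Finset.map_eq_image, Finset.image_image, Finset.image_image]
      exact Finset.image_congr fun x _ => hg x
    obtain ⟨m, hm, hle'⟩ := hT.exists_hasModel_of_labelling hH g (W.map (.subtype _))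
      (by rintro x hx; simp at hx; exact hx.1) (by
        intro x hx y hy hxy
        obtain ⟨x, hxW, rfl⟩ := Finset.mem_map.1 hx
        obtain ⟨y, hyW, rfl⟩ := Finset.mem_map.1 hy
        have hxy : f x ≠ f y := by
          intro h
          exact hxy ((hg x).trans ((congrArg some h).trans (hg y).symm))
        by_contra hcon
        exact hf x hxW y hyW hxy ⟨fun h => hxy (congrArg f h), hcon⟩)
    rw [himg, Finset.card_image_of_injective _ (Option.some_injective _), Finset.card_map] at hle'
    rw [← Finset.coe_image, Set.ncard_coe_finset] at hle
    refine ⟨m, by omega, hm.mono ?_ le_rfl⟩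
    rintro x hx
    simp at hx
    exact hx.1

end Hypergraph

theorem theorem2 {α : Type*} (H : Hypergraph α) (hH : H.IsFiniteLoopless) (t : ℕ) (ht : 2 ≤ t)
    (hα : H.independenceNumber ≤ 2)
    (hminor : ¬ (Hypergraph.completeGraph t).IsMinor H) :
    H.chromaticNumber ≤ ((⌈(3 / 2 : ℚ) * ((t : ℚ) - 1)⌉₊ : ℕ) : ℕ∞) := by
  have hnt : ∀ e ∈ H.edgeSet, e.Nontrivial := fun e he =>
    Set.one_lt_encard_iff_nontrivial.1 (lt_of_lt_of_le (by norm_num) (hH.2 e he))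
  have hT := Hypergraph.triplesSpan_of_independenceNumber_le hα
  refine (hT.chromaticNumber_le_or_hasModel hnt hH.1 _).resolve_right ?_
  rintro ⟨m, hlt, hm⟩
  -- Thus `3 * (t - 1) ≤ 2 * k < 3 * m`.
  have hceil := Nat.le_ceil ((3 / 2 : ℚ) * ((t : ℚ) - 1))
  have htm : t ≤ m := by
    have h1 : (2 * (⌈(3 / 2 : ℚ) * ((t : ℚ) - 1)⌉₊ : ℚ)) < 3 * m := by exact_mod_cast hlt
    have h2 : (t : ℚ) < m + 1 := by linarith
    exact Nat.lt_succ_iff.1 (by exact_mod_cast h2)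
  obtain ⟨B, hB, -⟩ := hm.mono subset_rfl htm
  exact hminor (hB.isMinor hnt)
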